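/- Let $n$ be a positive integer and $\mathbf{N}=\{1,\dots,n\}$. The $0$-Hecke monoid $\mathcal{H}_n$ is generated by $e_1,\dots,e_{n-1}$ subject to $e_i^2=e_i$, $e_ie_j=e_je_i$ for $i\neq j\pm1$, and $e_ie_{i+1}e_i=e_{i+1}e_ie_{i+1}$. For $w\in S_n$ with a reduced decomposition $w=s_{i_1}\cdots s_{i_k}$ into simple transpositions, put $z_w=e_{i_1}\cdots e_{i_k}$ (this does not depend on the reduced decomposition). Permutations and transformations are composed from right to left. Let $\Psi$ be the homomorphism from $\mathcal{H}_n$ to the monoid of binary relations on $\mathbf{N}$ (product: $(i,j)\in\xi\eta$ iff $(i,s)\in\xi$ and $(s,j)\in\eta$ for some $s$) that sends $e_i$ to the relation $\varepsilon_i=\{(a,b): a=b\text{ or }a=s_i(b)\}$. Let $\mathbf{C}_n^+$ be the monoid, under composition, of all order preserving maps $\alpha\colon\mathbf{N}\to\mathbf{N}$ with $\alpha(i)\geq i$ for all $i$, and let $\overline{\mathfrak{p}}\colon\mathcal{H}_n\to\mathbf{C}_n^+$ be given by $\overline{\mathfrak{p}}(x)(j)=\max\{i:(i,j)\in\Psi(x)\}$.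 For $\alpha,\beta\in\mathbf{C}_n^+$ write $\alpha\prec\beta$ if there are $\gamma_1,\gamma_2\in\mathbf{C}_n^+$ with $\beta=\gamma_1\alpha$ and $\beta=\alpha\gamma_2$. Let $\mathfrak{D}_n$ be the set of Dyck paths of semilength $n$, and let $\Delta\colon\mathbf{C}_n^+\to\mathfrak{D}_n$ be the bijection that sends $\alpha$ to the path consisting, for $k=n,n-1,\dots,1$ in this order, of one up step followed by $\alpha(k)-\alpha(k-1)$ down steps, where $\alpha(0)=0$. For $\alpha\in\mathbf{C}_n^+$ let $\pi_\alpha$ be the unique $321$-avoiding permutation in $S_n$ with $\overline{\mathfrak{p}}(z_{\pi_\alpha})=\alpha$; explicitly, for $i=1,\dots,n$, $\pi_\alpha(i)=\alpha(i)$ if $\alpha(i)>\alpha(i-1)$, and $\pi_\alpha(i)=\min(\mathbf{N}\setminus\{\pi_\alpha(j):j<i\})$ otherwise. Define $\mathfrak{i}\colon\mathfrak{D}_n\to\mathfrak{D}_n$ (the first derivative of the Kreweras involution) by $$\mathfrak{i}(\Delta(\alpha))=\Delta\bigl(\overline{\mathfrak{p}}(z_{\pi_\alpha^{-1}})\bigr).$$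 A pair $(\delta,\delta')$ of Dyck paths in $\mathfrak{D}_n$ is called admissible if there is $w\in S_n$ with $\delta=\Delta(\overline{\mathfrak{p}}(z_w))$ and $\delta'=\Delta(\overline{\mathfrak{p}}(z_{w^{-1}}))$. Then a pair $(\delta,\delta')$ of Dyck paths in $\mathfrak{D}_n$ is admissible if and only if $$\Delta^{-1}(\mathfrak{i}(\delta))\prec\Delta^{-1}(\delta')\qquad\text{and}\qquad\Delta^{-1}(\mathfrak{i}(\delta'))\prec\Delta^{-1}(\delta).$$ -/

import Mathlib

/-! Conventions: the set `{1, …, n}` is modelled by `Fin n`, and the index set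
`{1, …, n - 1}` of the simple transpositions by `Fin (n - 1)`. -/

namespace DoubleCatalan

/-! ### Simple transpositions and reduced words -/

/-- The simple transposition exchanging the `i`-th and the `(i+1)`-st point. -/
def simpleSwap {n : ℕ} (i : Fin (n - 1)) : Equiv.Perm (Fin n) :=
  Equiv.swap ⟨i, by omega⟩ ⟨i + 1, by omega⟩

/-- The permutation `s_{i₁} s_{i₂} ⋯ s_{i_k}` given by a word in the simple transpositions. -/
def wordProd {n : ℕ} (l : List (Fin (n - 1))) : Equiv.Perm (Fin n) :=
  (l.map simpleSwap).prod

/-- `l` is a reduced decomposition of `w`: a word for `w` of least possible length. -/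
def IsReducedWord {n : ℕ} (w : Equiv.Perm (Fin n)) (l : List (Fin (n - 1))) : Prop :=
  wordProd l = w ∧ ∀ l' : List (Fin (n - 1)), wordProd l' = w → l.length ≤ l'.length

theorem exists_word {n : ℕ} (w : Equiv.Perm (Fin n)) :
    ∃ l : List (Fin (n - 1)), wordProd l = w := by
  cases n with
  | zero => exact ⟨[], Subsingleton.elim _ _⟩
  | succ n =>
    have hw : w ∈ Submonoid.closure
        (Set.range fun i : Fin n ↦ Equiv.swap i.castSucc i.succ) := by
      rw [Equiv.Perm.mclosure_swap_castSucc_succ]; trivial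
    induction hw using Submonoid.closure_induction with
    | mem x hx =>
      obtain ⟨i, rfl⟩ := hx
      refine ⟨[i], ?_⟩
      simp only [wordProd, List.map_cons, List.map_nil, List.prod_cons, List.prod_nil, mul_one]
      rfl
    | one => exact ⟨[], rfl⟩
    | mul x y _ _ hx hy =>
      obtain ⟨l, rfl⟩ := hx
      obtain ⟨l', rfl⟩ := hy
      exact ⟨l ++ l', by simp [wordProd]⟩

theorem exists_reducedWord {n : ℕ} (w : Equiv.Perm (Fin n)) :
    ∃ l : List (Fin (n - 1)), IsReducedWord w l := by
  classical
  have h : ∃ k, ∃ l : List (Fin (n - 1)), wordProd l = w ∧ l.length = k := by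
    obtain ⟨l, hl⟩ := exists_word w
    exact ⟨_, l, hl, rfl⟩
  obtain ⟨l, hl, hk⟩ := Nat.find_spec h
  exact ⟨l, hl, fun l' hl' ↦ hk ▸ Nat.find_min' h ⟨l', hl', rfl⟩⟩

/-! ### The 0-Hecke monoid -/

/-- The defining relations of the 0-Hecke monoid. -/
inductive HeckeRel (n : ℕ) : FreeMonoid (Fin (n - 1)) → FreeMonoid (Fin (n - 1)) → Prop
  | idem (i : Fin (n - 1)) :
      HeckeRel n (FreeMonoid.of i * FreeMonoid.of i) (FreeMonoid.of i)
  | comm (i j : Fin (n - 1)) (h₁ : (i : ℕ) ≠ j + 1) (h₂ : (j : ℕ) ≠ i + 1) :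
      HeckeRel n (FreeMonoid.of i * FreeMonoid.of j) (FreeMonoid.of j * FreeMonoid.of i)
  | braid (i j : Fin (n - 1)) (h : (j : ℕ) = i + 1) :
      HeckeRel n (FreeMonoid.of i * FreeMonoid.of j * FreeMonoid.of i)
        (FreeMonoid.of j * FreeMonoid.of i * FreeMonoid.of j)

/-- The 0-Hecke monoid `H_n`. -/
abbrev Hecke (n : ℕ) : Type := PresentedMonoid (HeckeRel n)

/-- The generator `e_i` of the 0-Hecke monoid. -/
def heckeGen {n : ℕ} (i : Fin (n - 1)) : Hecke n := PresentedMonoid.of (HeckeRel n) i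

/-- The element `z_w = e_{i₁} ⋯ e_{i_k}`, for a reduced decomposition `w = s_{i₁} ⋯ s_{i_k}`
(by Matsumoto's theorem the choice of the reduced decomposition does not matter). -/
noncomputable def heckeElt {n : ℕ} (w : Equiv.Perm (Fin n)) : Hecke n :=
  ((exists_reducedWord w).choose.map heckeGen).prod

/-! ### Binary relations -/

/-- Binary relations on `{1, …, n}`, i.e. `n × n` boolean matrices. -/
def BinRel (n : ℕ) : Type := Fin n → Fin n → Prop

/-- Composition of relations, i.e. the product of boolean matrices. -/
instance (n : ℕ) : Monoid (BinRel n) where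
  mul ξ η := fun i j ↦ ∃ s, ξ i s ∧ η s j
  one := fun i j ↦ i = j
  mul_assoc ξ η ζ := by
    funext i j
    apply propext
    constructor
    · rintro ⟨s, ⟨t, h₁, h₂⟩, h₃⟩
      exact ⟨t, h₁, s, h₂, h₃⟩
    · rintro ⟨s, h₁, t, h₂, h₃⟩
      exact ⟨t, ⟨s, h₁, h₂⟩, h₃⟩
  one_mul ξ := by
    funext i j
    apply propext
    constructor
    · rintro ⟨s, rfl, h⟩
      exact h
    · exact fun h ↦ ⟨i, rfl, h⟩
  mul_one ξ := by
    funext i j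
    apply propext
    constructor
    · rintro ⟨s, h, rfl⟩
      exact h
    · exact fun h ↦ ⟨j, h, rfl⟩

theorem BinRel.mul_iff {n : ℕ} (ξ η : BinRel n) (i j : Fin n) :
    (ξ * η) i j ↔ ∃ s, ξ i s ∧ η s j := Iff.rfl

theorem BinRel.one_iff {n : ℕ} (i j : Fin n) : (1 : BinRel n) i j ↔ i = j := Iff.rfl

/-- The usual embedding of the symmetric group: the graph of a permutation, with
`(i, j)` in the relation if and only if `i = w(j)`. -/
def permRel {n : ℕ} (w : Equiv.Perm (Fin n)) : BinRel n := fun i j ↦ i = w j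

/-- The relation `ε_i`: the (boolean) sum of the identity and of the `i`-th simple
transposition. -/
def eps {n : ℕ} (i : Fin (n - 1)) : BinRel n :=
  fun a b ↦ permRel 1 a b ∨ permRel (simpleSwap i) a b

/-- Convex relations: reflexive, and all rows and columns are intervals. -/
structure IsConvex {n : ℕ} (ξ : BinRel n) : Prop where
  refl : ∀ i, ξ i i
  column : ∀ j, Set.OrdConnected {i | ξ i j}
  row : ∀ i, Set.OrdConnected {j | ξ i j}

theorem eps_iff {n : ℕ} (i : Fin (n - 1)) (a b : Fin n) :
    eps i a b ↔ (a : ℕ) = b ∨ ((a : ℕ) = i ∧ (b : ℕ) = i + 1) ∨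
      ((a : ℕ) = i + 1 ∧ (b : ℕ) = i) := by
  unfold eps permRel simpleSwap
  rw [Equiv.swap_apply_def]
  simp only [Equiv.Perm.coe_one, id, Fin.ext_iff]
  split_ifs <;> simp_all

theorem isConvex_eps {n : ℕ} (i : Fin (n - 1)) : IsConvex (eps i) where
  refl a := Or.inl rfl
  column j := ⟨fun a ha b hb c hc ↦ by
    have h₁ : (a : ℕ) ≤ c := hc.1
    have h₂ : (c : ℕ) ≤ b := hc.2
    simp only [Set.mem_ofPred_eq, eps_iff] at *
    omega⟩
  row j := ⟨fun a ha b hb c hc ↦ by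
    have h₁ : (a : ℕ) ≤ c := hc.1
    have h₂ : (c : ℕ) ≤ b := hc.2
    simp only [Set.mem_ofPred_eq, eps_iff] at *
    omega⟩

theorem IsConvex.mul {n : ℕ} {ξ η : BinRel n} (hξ : IsConvex ξ) (hη : IsConvex η) :
    IsConvex (ξ * η) where
  refl i := ⟨i, hξ.refl i, hη.refl i⟩
  column j := ⟨by
    rintro a ⟨s, has, hsj⟩ b ⟨t, hbt, htj⟩ c ⟨hac, hcb⟩
    rcases le_total c s with hcs | hcs
    · exact ⟨s, (hξ.column s).out has (hξ.refl s) ⟨hac, hcs⟩, hsj⟩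
    · rcases le_total c t with hct | hct
      · exact ⟨c, hξ.refl c, (hη.column j).out hsj htj ⟨hcs, hct⟩⟩
      · exact ⟨t, (hξ.column t).out (hξ.refl t) hbt ⟨hct, hcb⟩, htj⟩⟩
  row i := ⟨by
    rintro a ⟨s, his, hsa⟩ b ⟨t, hit, htb⟩ c ⟨hac, hcb⟩
    rcases le_total c s with hcs | hcs
    · exact ⟨s, his, (hη.row s).out hsa (hη.refl s) ⟨hac, hcs⟩⟩
    · rcases le_total c t with hct | hct
      · exact ⟨c, (hξ.row i).out his hit ⟨hcs, hct⟩, hη.refl c⟩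
      · exact ⟨t, hit, (hη.row t).out (hη.refl t) htb ⟨hct, hcb⟩⟩⟩

/-- The monoid `CB_n` of convex binary relations. -/
def ConvexRel (n : ℕ) : Submonoid (BinRel n) where
  carrier := {ξ | IsConvex ξ}
  one_mem' := by
    refine ⟨fun i ↦ rfl, fun j ↦ ⟨?_⟩, fun j ↦ ⟨?_⟩⟩
    · rintro a ha b hb c hc
      simp only [Set.mem_ofPred_eq, BinRel.one_iff] at *
      subst ha; subst hb
      exact le_antisymm hc.2 hc.1
    · rintro a ha b hb c hc
      simp only [Set.mem_ofPred_eq, BinRel.one_iff] at *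
      subst ha; subst hb
      exact le_antisymm hc.1 hc.2
  mul_mem' h₁ h₂ := h₁.mul h₂

/-- `ε_i` as a convex relation. -/
def epsConvex {n : ℕ} (i : Fin (n - 1)) : ConvexRel n := ⟨eps i, isConvex_eps i⟩

theorem eps_idem {n : ℕ} (i : Fin (n - 1)) : eps i * eps i = eps i := by
  funext a b
  apply propext
  rw [BinRel.mul_iff]
  constructor
  · rintro ⟨s, h₁, h₂⟩
    rw [eps_iff] at *
    omega
  · exact fun h ↦ ⟨a, Or.inl rfl, h⟩

theorem eps_comm_le {n : ℕ} (i j : Fin (n - 1)) (h₁ : (i : ℕ) ≠ j + 1) (h₂ : (j : ℕ) ≠ i + 1)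
    (a b : Fin n) (h : (eps i * eps j) a b) : (eps j * eps i) a b := by
  obtain ⟨s, h₃, h₄⟩ := h
  by_cases hij : i = j
  · subst hij
    exact ⟨s, h₃, h₄⟩
  have hij' : (i : ℕ) ≠ j := fun h ↦ hij (Fin.ext h)
  rw [eps_iff] at h₃ h₄
  by_cases hs : (a : ℕ) = s
  · refine ⟨b, ?_, ?_⟩ <;> rw [eps_iff] <;> omega
  · refine ⟨a, ?_, ?_⟩ <;> rw [eps_iff] <;> omega

theorem eps_braid_aux {n : ℕ} (i j : Fin (n - 1)) (h : (j : ℕ) = i + 1) (a b : Fin n) :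
    ((eps i * eps j * eps i) a b ↔ ((a : ℕ) = b ∨
      ((i : ℕ) ≤ a ∧ (a : ℕ) ≤ i + 2 ∧ (i : ℕ) ≤ b ∧ (b : ℕ) ≤ i + 2))) ∧
    ((eps j * eps i * eps j) a b ↔ ((a : ℕ) = b ∨
      ((i : ℕ) ≤ a ∧ (a : ℕ) ≤ i + 2 ∧ (i : ℕ) ≤ b ∧ (b : ℕ) ≤ i + 2))) := by
  have hi := i.2
  have hj := j.2
  constructor
  · simp only [BinRel.mul_iff, eps_iff]
    constructor
    · rintro ⟨s, ⟨t, h₁, h₂⟩, h₃⟩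
      omega
    · intro hab
      by_cases hb : (b : ℕ) = i
      · by_cases ha : (a : ℕ) = i + 2
        · exact ⟨⟨i + 1, by omega⟩, ⟨a, by simp, by simp; omega⟩, by simp; omega⟩
        · exact ⟨a, ⟨a, by simp, by simp⟩, by omega⟩
      · by_cases hb' : (b : ℕ) = i + 1
        · by_cases ha : (a : ℕ) = i + 2
          · exact ⟨b, ⟨a, by simp, by omega⟩, by simp⟩
          · exact ⟨a, ⟨a, by simp, by simp⟩, by omega⟩
        · by_cases ha : (a : ℕ) = i
          · by_cases hb'' : (b : ℕ) = i + 2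
            · exact ⟨b, ⟨⟨i + 1, by omega⟩, by simp; omega, by simp; omega⟩, by simp⟩
            · exact ⟨b, ⟨a, by simp, by omega⟩, by simp⟩
          · exact ⟨b, ⟨a, by simp, by omega⟩, by simp⟩
  · simp only [BinRel.mul_iff, eps_iff]
    constructor
    · rintro ⟨s, ⟨t, h₁, h₂⟩, h₃⟩
      omega
    · intro hab
      by_cases hb : (b : ℕ) = i + 2
      · by_cases ha : (a : ℕ) = i
        · exact ⟨⟨i + 1, by omega⟩, ⟨a, by simp, by simp; omega⟩, by simp; omega⟩
        · exact ⟨a, ⟨a, by simp, by simp⟩, by omega⟩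
      · by_cases ha : (a : ℕ) = i + 2
        · by_cases hb' : (b : ℕ) = i
          · exact ⟨b, ⟨⟨i + 1, by omega⟩, by simp; omega, by simp; omega⟩, by simp⟩
          · exact ⟨b, ⟨b, by omega, by simp⟩, by simp⟩
        · exact ⟨b, ⟨a, by simp, by omega⟩, by simp⟩

theorem epsConvex_rel {n : ℕ} (a b : FreeMonoid (Fin (n - 1))) (h : HeckeRel n a b) :
    FreeMonoid.lift epsConvex a = FreeMonoid.lift epsConvex b := by
  cases h with
  | idem i =>
    simp only [map_mul, FreeMonoid.lift_eval_of]
    exact Subtype.ext (eps_idem i)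
  | comm i j h₁ h₂ =>
    simp only [map_mul, FreeMonoid.lift_eval_of]
    refine Subtype.ext (funext fun a ↦ funext fun b ↦ propext ⟨?_, ?_⟩)
    · exact eps_comm_le i j h₁ h₂ a b
    · exact eps_comm_le j i h₂ h₁ a b
  | braid i j h =>
    simp only [map_mul, FreeMonoid.lift_eval_of]
    exact Subtype.ext (funext fun a ↦ funext fun b ↦ propext
      ((eps_braid_aux i j h a b).1.trans (eps_braid_aux i j h a b).2.symm))

/-- The homomorphism `Ψ` from the 0-Hecke monoid to (convex) binary relations with
`Ψ(e_i) = ε_i`; its image is the double Catalan monoid. -/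
def heckeToRel (n : ℕ) : Hecke n →* ConvexRel n :=
  PresentedMonoid.lift epsConvex epsConvex_rel

/-! ### The Catalan monoid -/

/-- The Catalan monoid `C_n^+` of order preserving and non-decreasing transformations of
`{1, …, n}`; the product is composition, `(f * g) x = f (g x)`. -/
def Catalan (n : ℕ) : Submonoid (Fin n →o Fin n) where
  carrier := {f | ∀ i, i ≤ f i}
  one_mem' := fun i ↦ le_refl i
  mul_mem' hf hg := fun i ↦ (hg i).trans (hf _)

open Classical in
/-- The transformation `max ξ`, which sends `j` to the largest `i` with `(i, j) ∈ ξ`. -/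
noncomputable def maxTrans {n : ℕ} (ξ : ConvexRel n) : Catalan n :=
  ⟨⟨fun j ↦ (Finset.univ.filter fun i ↦ ξ.1 i j).max' ⟨j, by simpa using ξ.2.refl j⟩, by
      intro a b hab
      apply Finset.max'_le
      intro m hm
      have hm' : ξ.1 m a := by simpa using hm
      rcases le_total m b with h | h
      · exact h.trans (Finset.le_max' _ _ (by simpa using ξ.2.refl b))
      · have hmb : ξ.1 m b := (ξ.2.row m).out hm' (ξ.2.refl m) ⟨hab, h⟩
        exact Finset.le_max' _ _ (by simpa using hmb)⟩,
    fun j ↦ Finset.le_max' _ _ (by simpa using ξ.2.refl j)⟩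

/-- The projection of the 0-Hecke monoid onto the Catalan monoid `C_n^+`: the
composition of `Ψ` with `ξ ↦ max ξ`, the first component of `ξ ↦ (max ξ, min ξ)`. -/
noncomputable def heckeToCatalan {n : ℕ} (x : Hecke n) : Catalan n :=
  maxTrans (heckeToRel n x)

/-- `α ≺ β` if and only if `β = γ₁ α` and `β = α γ₂` for some `γ₁, γ₂` in `C_n^+`. -/
def Prec {n : ℕ} (α β : Catalan n) : Prop :=
  ∃ γ₁ γ₂ : Catalan n, β = γ₁ * α ∧ β = α * γ₂

/-- The value `α(k)` with `1`-based argument and value, and with `α(0) = 0`. -/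
def catVal {n : ℕ} (α : Catalan n) (k : ℕ) : ℕ :=
  if h : 0 < k ∧ k ≤ n then (α.1 ⟨k - 1, by omega⟩ : ℕ) + 1 else 0

theorem catVal_zero {n : ℕ} (α : Catalan n) : catVal α 0 = 0 := rfl

theorem catVal_succ {n : ℕ} (α : Catalan n) (i : Fin n) :
    catVal α (i + 1) = (α.1 i : ℕ) + 1 := by
  unfold catVal
  rw [dif_pos ⟨Nat.succ_pos _, i.2⟩]
  rfl

theorem catVal_mono {n : ℕ} (α : Catalan n) {k l : ℕ} (h : k ≤ l) (hl : l ≤ n) :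
    catVal α k ≤ catVal α l := by
  rcases k with _ | k
  · simp [catVal_zero]
  rcases l with _ | l
  · omega
  rw [catVal_succ α ⟨k, by omega⟩, catVal_succ α ⟨l, by omega⟩]
  have : α.1 ⟨k, by omega⟩ ≤ α.1 ⟨l, by omega⟩ :=
    α.1.monotone (show k ≤ l by omega)
  exact Nat.succ_le_succ this

theorem le_catVal {n : ℕ} (α : Catalan n) {k : ℕ} (h : k ≤ n) : k ≤ catVal α k := by
  rcases k with _ | k
  · simp
  rw [catVal_succ α ⟨k, by omega⟩]
  exact Nat.succ_le_succ (α.2 ⟨k, by omega⟩)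

theorem catVal_le {n : ℕ} (α : Catalan n) (k : ℕ) : catVal α k ≤ n := by
  unfold catVal
  split_ifs with h
  · exact (α.1 _).2
  · exact Nat.zero_le n

theorem catVal_self {n : ℕ} (α : Catalan n) : catVal α n = n :=
  le_antisymm (catVal_le α n) (le_catVal α le_rfl)

/-! ### Dyck paths and the bijection `Δ` -/

/-- Dyck paths of semilength `n`; `U` is the step `(1, 1)` and `D` is the step `(1, -1)`. -/
abbrev DyckPath (n : ℕ) : Type := {p : DyckWord // p.semilength = n}

open DyckStep

/-- The boundary of the matrix of `α`, read from its lower right to its upper left corner: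
for the columns `k, k - 1, …, 1`, an up step followed by `α(k) - α(k - 1)` down steps. -/
def boundary (a : ℕ → ℕ) : ℕ → List DyckStep
  | 0 => []
  | k + 1 => U :: (List.replicate (a (k + 1) - a k) D ++ boundary a k)

theorem count_boundary (a : ℕ → ℕ) (h0 : a 0 = 0) (k : ℕ)
    (ha : ∀ j, j < k → a j ≤ a (j + 1)) :
    (boundary a k).count U = k ∧ (boundary a k).count D = a k := by
  induction k with
  | zero => simp [boundary, h0]
  | succ k ih =>
    obtain ⟨h₁, h₂⟩ := ih fun j hj ↦ ha j (by omega)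
    have := ha k (by omega)
    constructor
    · simp [boundary, List.count_replicate, h₁]
    · simp [boundary, h₂]; omega

theorem count_drop_boundary (a : ℕ → ℕ) (h0 : a 0 = 0) (k : ℕ)
    (ha : ∀ j, j < k → a j ≤ a (j + 1)) (hk : ∀ j, j ≤ k → j ≤ a j) (i : ℕ) :
    ((boundary a k).drop i).count U ≤ ((boundary a k).drop i).count D := by
  induction k generalizing i with
  | zero => simp [boundary]
  | succ k ih =>
    rcases i with _ | i
    · rw [List.drop_zero, (count_boundary a h0 _ ha).1, (count_boundary a h0 _ ha).2]
      exact hk _ le_rfl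
    · have := ih (fun j hj ↦ ha j (by omega)) (fun j hj ↦ hk j (by omega))
        (i - (a (k + 1) - a k))
      simp only [boundary, List.drop_succ_cons, List.drop_append, List.drop_replicate,
        List.count_append, List.length_replicate, List.count_replicate]
      simp
      omega

/-- The Dyck path `Δ(α)`. -/
def deltaFun {n : ℕ} (α : Catalan n) : DyckPath n :=
  ⟨{ toList := boundary (catVal α) n
     count_U_eq_count_D := by
      have h := count_boundary (catVal α) (catVal_zero α) n
        fun j hj ↦ catVal_mono α (Nat.le_succ j) hj
      rw [h.1, h.2, catVal_self]
     count_D_le_count_U := fun i ↦ by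
      have h := count_boundary (catVal α) (catVal_zero α) n
        fun j hj ↦ catVal_mono α (Nat.le_succ j) hj
      have h' := count_drop_boundary (catVal α) (catVal_zero α) n
        (fun j hj ↦ catVal_mono α (Nat.le_succ j) hj) (fun j hj ↦ le_catVal α hj) i
      rw [catVal_self, ← List.take_append_drop i (boundary (catVal α) n)] at h
      simp only [List.count_append] at h
      omega },
    (count_boundary (catVal α) (catVal_zero α) n
      fun j hj ↦ catVal_mono α (Nat.le_succ j) hj).1⟩

/-- The number of down steps of `l` after its `j`-th up step, counted from the right. -/
def downsAfter : List DyckStep → ℕ → ℕ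
  | [], _ => 0
  | D :: l, j => downsAfter l j
  | U :: l, j => if j = l.count U + 1 then l.count D else downsAfter l j

theorem downsAfter_replicate (m : ℕ) (l : List DyckStep) (j : ℕ) :
    downsAfter (List.replicate m D ++ l) j = downsAfter l j := by
  induction m with
  | zero => rfl
  | succ m ih => simpa [List.replicate_succ, downsAfter] using ih

theorem downsAfter_boundary (a : ℕ → ℕ) (h0 : a 0 = 0) (k : ℕ)
    (ha : ∀ j, j < k → a j ≤ a (j + 1)) (j : ℕ) (hj : 0 < j) (hjk : j ≤ k) :
    downsAfter (boundary a k) j = a j := by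
  induction k with
  | zero => omega
  | succ k ih =>
    have hc := count_boundary a h0 k fun j hj ↦ ha j (by omega)
    have hk := ha k (by omega)
    have hU : (List.replicate (a (k + 1) - a k) D ++ boundary a k).count U = k := by
      simp [List.count_replicate, hc]
    have hD : (List.replicate (a (k + 1) - a k) D ++ boundary a k).count D = a (k + 1) := by
      simp [hc]; omega
    simp only [boundary, downsAfter, downsAfter_replicate, hU, hD]
    split_ifs with h
    · rw [h]
    · exact ih (fun j hj ↦ ha j (by omega)) (by omega)

theorem downsAfter_le (l : List DyckStep) (j : ℕ) : downsAfter l j ≤ l.count D := by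
  induction l with
  | nil => simp [downsAfter]
  | cons s l ih =>
    cases s
    · simp only [downsAfter]
      split_ifs <;> simp [ih]
    · simp only [downsAfter]
      simp
      omega

theorem downsAfter_eq_zero (l : List DyckStep) (j : ℕ) (h : l.count U < j) :
    downsAfter l j = 0 := by
  induction l with
  | nil => simp [downsAfter]
  | cons s l ih =>
    cases s
    · simp at h
      simp only [downsAfter]
      rw [if_neg (by omega)]
      exact ih (by omega)
    · simp at h
      exact ih h

theorem downsAfter_zero (l : List DyckStep) : downsAfter l 0 = 0 := by
  induction l with
  | nil => rfl
  | cons s l ih => cases s <;> simp [downsAfter, ih]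

theorem downsAfter_mono (l : List DyckStep) (j : ℕ) (h : j < l.count U) :
    downsAfter l j ≤ downsAfter l (j + 1) := by
  induction l with
  | nil => simp at h
  | cons s l ih =>
    cases s
    · simp at h
      simp only [downsAfter]
      rw [if_neg (by omega)]
      split_ifs with h'
      · exact downsAfter_le l j
      · exact ih (by omega)
    · simp at h
      exact ih h

theorem le_downsAfter (l : List DyckStep) (hl : ∀ i, (l.drop i).count U ≤ (l.drop i).count D)
    (j : ℕ) (h : j ≤ l.count U) : j ≤ downsAfter l j := by
  induction l with
  | nil => simpa [downsAfter] using h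
  | cons s l ih =>
    have ih' := ih fun i ↦ by simpa using hl (i + 1)
    cases s
    · simp at h
      simp only [downsAfter]
      split_ifs with h'
      · have := hl 0
        simp at this
        omega
      · exact ih' (by omega)
    · simp at h
      exact ih' h

theorem boundary_congr (a b : ℕ → ℕ) (k : ℕ) (h : ∀ j, j ≤ k → a j = b j) :
    boundary a k = boundary b k := by
  induction k with
  | zero => rfl
  | succ k ih =>
    simp only [boundary]
    rw [h (k + 1) le_rfl, h k (by omega), ih fun j hj ↦ h j (by omega)]

theorem eq_replicate_append_boundary (l : List DyckStep) :
    l = List.replicate (l.count D - downsAfter l (l.count U)) D ++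
      boundary (downsAfter l) (l.count U) := by
  induction l with
  | nil => rfl
  | cons s l ih =>
    cases s
    · have h : boundary (downsAfter (U :: l)) (l.count U) =
          boundary (downsAfter l) (l.count U) := by
        apply boundary_congr
        intro j hj
        simp only [downsAfter]
        rw [if_neg (by omega)]
      have h₁ : downsAfter (U :: l) (l.count U + 1) = l.count D := by simp [downsAfter]
      have h₂ : downsAfter (U :: l) (l.count U) = downsAfter l (l.count U) := by
        simp [downsAfter]
      have e₁ : (U :: l).count U = l.count U + 1 := by simp
      have e₂ : (U :: l).count D = l.count D := by simp
      rw [e₁, e₂]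
      simp only [boundary]
      rw [h, h₁, h₂, ← ih]
      simp
    · have e₁ : (D :: l).count U = l.count U := by simp
      have e₂ : (D :: l).count D = l.count D + 1 := by simp
      have e₃ : downsAfter (D :: l) = downsAfter l := rfl
      rw [e₁, e₂, e₃, Nat.sub_add_comm (downsAfter_le l _), List.replicate_succ,
        List.cons_append, ← ih]

theorem deltaFun_bijective (n : ℕ) : Function.Bijective (deltaFun (n := n)) := by
  constructor
  · intro α β h
    have h' : boundary (catVal α) n = boundary (catVal β) n :=
      congrArg (fun p : DyckPath n ↦ p.1.toList) h
    refine Subtype.ext (OrderHom.ext _ _ (funext fun i ↦ Fin.ext ?_))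
    have hα := downsAfter_boundary (catVal α) (catVal_zero α) n
      (fun j hj ↦ catVal_mono α (Nat.le_succ j) hj) (i + 1) (Nat.succ_pos _) i.2
    have hβ := downsAfter_boundary (catVal β) (catVal_zero β) n
      (fun j hj ↦ catVal_mono β (Nat.le_succ j) hj) (i + 1) (Nat.succ_pos _) i.2
    rw [h', hβ, catVal_succ, catVal_succ] at hα
    exact (Nat.succ.inj hα).symm
  · rintro ⟨p, hp⟩
    have hU : p.toList.count U = n := hp
    have hD : p.toList.count D = n := p.count_U_eq_count_D ▸ hp
    have hdrop : ∀ i, (p.toList.drop i).count U ≤ (p.toList.drop i).count D := by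
      intro i
      have h₁ := p.count_D_le_count_U i
      have h₂ := congrArg (List.count U) (List.take_append_drop i p.toList)
      have h₃ := congrArg (List.count D) (List.take_append_drop i p.toList)
      rw [List.count_append] at h₂ h₃
      omega
    have hle := fun j ↦ le_downsAfter p.toList hdrop j
    have hub := fun j ↦ downsAfter_le p.toList j
    rw [hU] at hle
    rw [hD] at hub
    have hmono : ∀ k l, k ≤ l → l ≤ n → downsAfter p.toList k ≤ downsAfter p.toList l := by
      intro k l hkl
      induction l, hkl using Nat.le_induction with
      | base => exact fun _ ↦ le_rfl
      | succ l _ ih =>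
        intro hl
        exact (ih (by omega)).trans (downsAfter_mono _ l (by omega))
    have hval : ∀ i : Fin n, downsAfter p.toList (i + 1) - 1 < n := fun i ↦ by
      have h₁ := hle (i + 1) i.2
      have h₂ := hub (i + 1)
      omega
    refine ⟨⟨⟨fun i ↦ ⟨downsAfter p.toList (i + 1) - 1, hval i⟩, ?_⟩, ?_⟩, ?_⟩
    · intro i j hij
      exact Nat.sub_le_sub_right (hmono _ _ (Nat.succ_le_succ hij) j.2) 1
    · intro i
      have h₁ := hle (i + 1) i.2
      show (i : ℕ) ≤ downsAfter p.toList (i + 1) - 1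
      omega
    · apply Subtype.ext
      apply DyckWord.ext
      have key := eq_replicate_append_boundary p.toList
      rw [hU, hD, le_antisymm (hub n) (hle n le_rfl), Nat.sub_self] at key
      refine Eq.trans (boundary_congr _ _ n fun j hj ↦ ?_) key.symm
      rcases j with _ | j
      · rw [catVal_zero, downsAfter_zero]
      · rw [catVal_succ _ ⟨j, hj⟩]
        have := hle (j + 1) hj
        show downsAfter p.toList (j + 1) - 1 + 1 = downsAfter p.toList (j + 1)
        omega

/-- The bijection `Δ` from the Catalan monoid `C_n^+` onto the Dyck paths of semilength `n`. -/
noncomputable def delta (n : ℕ) : Catalan n ≃ DyckPath n :=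
  Equiv.ofBijective deltaFun (deltaFun_bijective n)

/-! ### The 321-avoiding permutation `π_α` and the involution on Dyck paths -/

/-- The `0`-based values of `π_α`: `π_α(i) = α(i)` if `α(i) > α(i - 1)`, and otherwise
`π_α(i)` is the smallest value that is not among the `π_α(j)` with `j < i`. -/
noncomputable def piVal {n : ℕ} (α : Catalan n) (i : ℕ) : ℕ :=
  if catVal α i < catVal α (i + 1) then catVal α (i + 1) - 1
  else sInf {m : ℕ | ∀ j : Fin i, piVal α j ≠ m}
decreasing_by exact j.2

theorem piVal_of_lt {n : ℕ} (α : Catalan n) (i : ℕ) (h : catVal α i < catVal α (i + 1)) :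
    piVal α i = catVal α (i + 1) - 1 := by
  rw [piVal, if_pos h]

theorem piVal_of_not_lt {n : ℕ} (α : Catalan n) (i : ℕ)
    (h : ¬ catVal α i < catVal α (i + 1)) :
    piVal α i = sInf {m : ℕ | ∀ j : Fin i, piVal α j ≠ m} := by
  rw [piVal, if_neg h]

theorem exists_unused {n : ℕ} (α : Catalan n) (i : ℕ) :
    ∃ m ≤ i, ∀ j : Fin i, piVal α j ≠ m := by
  by_contra! h
  choose f hf using fun m : Fin (i + 1) ↦ h m (Nat.lt_succ_iff.1 m.2)
  have hinj : Function.Injective f := fun a b hab ↦ Fin.ext (by rw [← hf a, ← hf b, hab])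
  simpa using Fintype.card_le_of_injective f hinj

theorem piVal_lt_catVal {n : ℕ} (α : Catalan n) (i : ℕ) (hi : i < n) :
    piVal α i < catVal α (i + 1) := by
  have h₀ := le_catVal α (k := i + 1) hi
  by_cases h : catVal α i < catVal α (i + 1)
  · rw [piVal_of_lt α i h]
    omega
  · rw [piVal_of_not_lt α i h]
    obtain ⟨m, hm, hm'⟩ := exists_unused α i
    have : sInf {m : ℕ | ∀ j : Fin i, piVal α j ≠ m} ≤ m := Nat.sInf_le hm'
    omega

theorem piVal_ne {n : ℕ} (α : Catalan n) (j i : ℕ) (hji : j < i) (hi : i < n) :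
    piVal α j ≠ piVal α i := by
  by_cases h : catVal α i < catVal α (i + 1)
  · have h₁ := piVal_lt_catVal α j (by omega)
    have h₂ := catVal_mono α (show j + 1 ≤ i by omega) (by omega)
    rw [piVal_of_lt α i h]
    omega
  · obtain ⟨m, _, hm⟩ := exists_unused α i
    have : piVal α i ∈ {m : ℕ | ∀ j : Fin i, piVal α j ≠ m} := by
      rw [piVal_of_not_lt α i h]
      exact Nat.sInf_mem ⟨m, hm⟩
    exact this ⟨j, hji⟩

/-- The permutation `π_α`. -/
noncomputable def piPerm {n : ℕ} (α : Catalan n) : Equiv.Perm (Fin n) :=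
  Equiv.ofBijective
    (fun i ↦ ⟨piVal α i, (piVal_lt_catVal α i i.2).trans_le (catVal_le α _)⟩)
    (Finite.injective_iff_bijective.1 fun i j h ↦ by
      have h' : piVal α i = piVal α j := Fin.ext_iff.1 h
      rcases lt_trichotomy i j with hij | hij | hij
      · exact absurd h' (piVal_ne α i j hij j.2)
      · exact hij
      · exact absurd h'.symm (piVal_ne α j i hij i.2))

/-- `w` contains no pattern `321`. -/
def Avoids321 {n : ℕ} (w : Equiv.Perm (Fin n)) : Prop :=
  ¬ ∃ i j k : Fin n, i < j ∧ j < k ∧ w j < w i ∧ w k < w j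

theorem avoids321_piPerm {n : ℕ} (α : Catalan n) : Avoids321 (piPerm α) := by
  rintro ⟨i, j, k, hij, hjk, h₁, h₂⟩
  have h₁' : piVal α j < piVal α i := h₁
  have h₂' : piVal α k < piVal α j := h₂
  have hij' : (i : ℕ) < j := hij
  have hjk' : (j : ℕ) < k := hjk
  by_cases h : catVal α j < catVal α (j + 1)
  · have h₃ := piVal_lt_catVal α i i.2
    have h₄ := catVal_mono α (show (i : ℕ) + 1 ≤ j by omega) (by omega)
    rw [piVal_of_lt α j h] at h₁'
    omega
  · rw [piVal_of_not_lt α j h] at h₂'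
    exact Nat.notMem_of_lt_sInf h₂' fun l ↦ piVal_ne α l k (by omega) k.2

/-- The left-to-right maxima of `π_α` are given by `α`. -/
theorem isGreatest_piPerm {n : ℕ} (α : Catalan n) (i : Fin n) :
    IsGreatest {x | ∃ j ≤ i, piPerm α j = x} (α.1 i) := by
  have hrec : ∀ i : ℕ, i < n → ∃ j ≤ i, piVal α j + 1 = catVal α (i + 1) := by
    intro i
    induction i with
    | zero =>
      intro hi
      have h := le_catVal α (k := 1) hi
      refine ⟨0, le_rfl, ?_⟩
      rw [piVal_of_lt α 0 (by rw [catVal_zero]; exact h)]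
      exact Nat.sub_add_cancel h
    | succ i ih =>
      intro hi
      by_cases h : catVal α (i + 1) < catVal α (i + 1 + 1)
      · refine ⟨i + 1, le_rfl, ?_⟩
        rw [piVal_of_lt α _ h]
        omega
      · obtain ⟨j, hj, hj'⟩ := ih (by omega)
        have := catVal_mono α (Nat.le_succ (i + 1)) hi
        refine ⟨j, by omega, ?_⟩
        rw [Nat.succ_eq_add_one] at this
        omega
  constructor
  · obtain ⟨j, hj, hj'⟩ := hrec i i.2
    rw [catVal_succ] at hj'
    have hjn : j < n := hj.trans_lt i.2
    exact ⟨⟨j, hjn⟩, hj, Fin.ext (Nat.succ.inj hj')⟩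
  · rintro x ⟨j, hj, rfl⟩
    have h₁ := piVal_lt_catVal α j j.2
    have h₂ := catVal_mono α (Nat.succ_le_succ hj) i.2
    rw [catVal_succ α i] at h₂
    exact Nat.lt_succ_iff.1 (h₁.trans_le h₂)

/-- The first derivative `i` of the Kreweras involution: `i(Δ(α))` is the Dyck path of the
image in `C_n^+` of `z_w`, where `w` is the inverse of `π_α`. -/
noncomputable def krewerasDerivative {n : ℕ} (δ : DyckPath n) : DyckPath n :=
  delta n (heckeToCatalan (heckeElt (piPerm ((delta n).symm δ))⁻¹))

/-- The pair `Δ_w` of Dyck paths attached to a permutation `w` and its inverse. -/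
noncomputable def dyckPair {n : ℕ} (w : Equiv.Perm (Fin n)) : DyckPath n × DyckPath n :=
  (delta n (heckeToCatalan (heckeElt w)), delta n (heckeToCatalan (heckeElt w⁻¹)))

/-- Admissible pairs of Dyck paths: those of the form `Δ_w`. -/
def IsAdmissible {n : ℕ} (δ δ' : DyckPath n) : Prop :=
  ∃ w : Equiv.Perm (Fin n), dyckPair w = (δ, δ')

end DoubleCatalan

namespace DoubleCatalan

open Equiv

/-! Everything reduces to left-to-right maxima ("records"). Along a reduced word, multiplying by
`eps i` on the left changes the top entry of a column exactly as multiplying by `simpleSwap i`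
changes the maximum of the permutation on an initial segment. Hence the image of `z_w` in the
Catalan monoid is the running maximum of `w` (`hasRunningMax_heckeToCatalan`). A running maximum
records precisely the positions and the values of the records, and `Prec` says that the smaller
function lies pointwise below and has all record positions and record values of the larger one
(`prec_iff_records`).

Necessity: let `A` avoid 321 and have the running maximum of `w`. It agrees with `w` at the common
records, and each of its other values is a record position of `A⁻¹`. This gives the inclusions of
records, and a pigeonhole argument gives the pointwise inequality (`inv_le_inv`, `prec_inv`).

Sufficiency: let `A` and `B` be the 321-avoiding permutations of the two paths. Prescribe `w = A` at
the records of `A` and `w⁻¹ = B` at those of `B`. The two prescriptions can only meet at a common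
fixed point (`eq_of_isRecord_of_isRecord`), so they extend to a permutation that is increasing on
the remaining points. A second pigeonhole argument shows that no value exceeds the intended running
maximum (`hasRunningMax_of_extends`); exchanging `w`, `A`, `B` with `w⁻¹`, `B`, `A` settles the
inverse. -/

theorem perm_apply_inv {α : Type*} (w : Perm α) (x : α) : w (w⁻¹ x) = x := w.apply_symm_apply x

theorem perm_inv_apply {α : Type*} (w : Perm α) (x : α) : w⁻¹ (w x) = x := w.symm_apply_apply x

/-! ### Reduced words -/

/-- The exchange property: the pair `a < b` is inverted, so some letter of the word inverts it, and
deleting that letter amounts to multiplying by the transposition. -/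
theorem swap_mul_exchange {n : ℕ} (l : List (Fin (n - 1))) (a b : Fin n) (hab : a < b)
    (h : (wordProd l)⁻¹ b < (wordProd l)⁻¹ a) :
    ∃ l' : List (Fin (n - 1)), l'.length < l.length ∧ wordProd l' = swap a b * wordProd l := by
  induction l generalizing a b with
  | nil => exact absurd h (by simpa [wordProd] using hab.le)
  | cons j l ih =>
    have hl : wordProd (j :: l) = simpleSwap j * wordProd l := by simp [wordProd]
    have hs : (simpleSwap j)⁻¹ = simpleSwap j := swap_inv _ _
    have hss : simpleSwap j * simpleSwap j = 1 := swap_mul_self _ _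
    rw [hl, mul_inv_rev, hs] at h
    -- If the first letter keeps the order of the pair, it is kept and the transposition is
    -- conjugated past it. Otherwise the pair is `{j, j + 1}`, and the first letter is the one to
    -- delete.
    rcases lt_or_ge (simpleSwap j a) (simpleSwap j b) with hlt | hge
    · obtain ⟨l', hl', hw⟩ := ih _ _ hlt h
      refine ⟨j :: l', by simpa using hl', ?_⟩
      have hc := mul_swap_eq_swap_mul (simpleSwap j) (simpleSwap j a) (simpleSwap j b)
      rw [← Perm.mul_apply, ← Perm.mul_apply, hss] at hc
      rw [hl, show wordProd (j :: l') = simpleSwap j * wordProd l' by simp [wordProd], hw,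
        ← mul_assoc, ← mul_assoc]
      exact congrArg (· * wordProd l) hc
    · refine ⟨l, by simp, ?_⟩
      have key : swap a b = simpleSwap j := by
        have hj : (a : ℕ) = j ∧ (b : ℕ) = j + 1 := by
          unfold simpleSwap at hge
          rw [swap_apply_def, swap_apply_def] at hge
          simp only [Fin.ext_iff, Fin.le_def, Fin.lt_def] at hge hab
          split_ifs at hge <;> simp_all <;> omega
        unfold simpleSwap
        congr 1 <;> exact Fin.ext (by simp [hj])
      rw [hl, key, ← mul_assoc, hss, one_mul]

/-- The inequality says that the first letter increases the length: were it false, the exchange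
property would give a word for `w` even shorter than `l`. -/
theorem IsReducedWord.tail {n : ℕ} {w : Perm (Fin n)} {i : Fin (n - 1)}
    {l : List (Fin (n - 1))} (h : IsReducedWord w (i :: l)) :
    IsReducedWord (wordProd l) l ∧ w = simpleSwap i * wordProd l ∧
      (wordProd l)⁻¹ ⟨i, by omega⟩ < (wordProd l)⁻¹ ⟨i + 1, by omega⟩ := by
  obtain ⟨h₁, h₂⟩ := h
  have hw : w = simpleSwap i * wordProd l := by rw [← h₁]; simp [wordProd]
  refine ⟨⟨rfl, fun l' hl' ↦ ?_⟩, hw, ?_⟩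
  · have := h₂ (i :: l') (by rw [hw, ← hl']; simp [wordProd])
    simpa using this
  · by_contra hlt
    have hne : (wordProd l)⁻¹ ⟨i, by omega⟩ ≠ (wordProd l)⁻¹ ⟨i + 1, by omega⟩ := by
      simp
    obtain ⟨l', hl', hw'⟩ := swap_mul_exchange l ⟨i, by omega⟩ ⟨i + 1, by omega⟩
      (by simp) (lt_of_le_of_ne (not_lt.1 hlt) hne.symm)
    have := h₂ l' (by rw [hw', hw]; rfl)
    simp at this
    omega

/-! ### Running maxima -/

/-- `α j` is the maximum of `w` on the points up to `j`. -/
def HasRunningMax {n : ℕ} (w : Perm (Fin n)) (α : Fin n → Fin n) : Prop :=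
  ∀ j, IsGreatest {x | ∃ l ≤ j, w l = x} (α j)

/-- The update rule for the top of a column, to be matched with that of `isGreatest_simpleSwap_mul`:
only a maximum equal to `i` moves, to `i + 1`. -/
theorem isGreatest_eps_mul {n : ℕ} (i : Fin (n - 1)) (ξ : BinRel n) (j m : Fin n)
    (h : IsGreatest {a | ξ a j} m) :
    IsGreatest {a | (eps i * ξ) a j}
      (if (m : ℕ) = i then ⟨i + 1, by omega⟩ else m) := by
  constructor
  · refine ⟨m, ?_, h.1⟩
    rw [eps_iff]
    split_ifs with hm
    · simp [hm]
    · simp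
  · rintro a ⟨s, has, hs⟩
    have hsm : (s : ℕ) ≤ m := h.2 hs
    rw [eps_iff] at has
    rw [Fin.le_def]
    split_ifs with hm
    · simp only; omega
    · omega

theorem isGreatest_simpleSwap_mul {n : ℕ} (i : Fin (n - 1)) (w : Perm (Fin n)) (j m : Fin n)
    (hi : w⁻¹ ⟨i, by omega⟩ < w⁻¹ ⟨i + 1, by omega⟩)
    (h : IsGreatest {x | ∃ l ≤ j, w l = x} m) :
    IsGreatest {x | ∃ l ≤ j, (simpleSwap i * w) l = x}
      (if (m : ℕ) = i then ⟨i + 1, by omega⟩ else m) := by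
  obtain ⟨⟨l, hl, rfl⟩, hub⟩ := h
  have hval : ∀ x : Fin n, ((simpleSwap i x : Fin n) : ℕ) =
      if (x : ℕ) = i then (i : ℕ) + 1 else if (x : ℕ) = i + 1 then (i : ℕ) else x := by
    intro x
    unfold simpleSwap
    rw [swap_apply_def]
    simp only [Fin.ext_iff]
    split_ifs <;> rfl
  constructor
  · by_cases h₁ : (w l : ℕ) = i
    · refine ⟨l, hl, Fin.ext ?_⟩
      rw [Perm.mul_apply, hval, if_pos h₁, if_pos h₁]
    · rw [if_neg h₁]
      -- A maximum `i + 1` is itself lowered to `i`, but by `hi` the value `i` occurs earlier and is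
      -- raised to `i + 1`, so the maximum stays.
      by_cases h₂ : (w l : ℕ) = i + 1
      · have hl' : w⁻¹ ⟨i + 1, by omega⟩ = l := by
          rw [Perm.inv_eq_iff_eq]; exact Fin.ext h₂.symm
        refine ⟨w⁻¹ ⟨i, by omega⟩, (hi.le.trans hl'.le).trans hl, Fin.ext ?_⟩
        rw [Perm.mul_apply, hval, perm_apply_inv, if_pos rfl, h₂]
      · refine ⟨l, hl, Fin.ext ?_⟩
        rw [Perm.mul_apply, hval, if_neg h₁, if_neg h₂]
  · rintro x ⟨k, hk, rfl⟩
    have hkl : (w k : ℕ) ≤ w l := hub ⟨k, hk, rfl⟩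
    rw [Fin.le_def, Perm.mul_apply, hval]
    by_cases h₁ : (w l : ℕ) = i
    · rw [if_pos h₁]; simp only; split_ifs <;> omega
    · rw [if_neg h₁]; split_ifs <;> omega

/-- Both maxima start at `j` for the empty word and follow the same update rule. The argument
applies to any reduced word, so the one chosen in `heckeElt` is immaterial. -/
theorem exists_isGreatest_of_isReducedWord {n : ℕ} (l : List (Fin (n - 1))) (w : Perm (Fin n))
    (h : IsReducedWord w l) (j : Fin n) :
    ∃ m, IsGreatest {a | ((l.map epsConvex).prod).1 a j} m ∧
      IsGreatest {x | ∃ k ≤ j, w k = x} m := by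
  induction l generalizing w with
  | nil =>
    obtain rfl : 1 = w := h.1
    refine ⟨j, ⟨rfl, ?_⟩, ⟨j, le_rfl, rfl⟩, ?_⟩
    · rintro a rfl
      exact le_rfl
    · rintro a ⟨k, hk, rfl⟩
      exact hk
  | cons i l ih =>
    obtain ⟨h₁, rfl, h₂⟩ := h.tail
    obtain ⟨m, hm, hm'⟩ := ih _ h₁
    exact ⟨_, isGreatest_eps_mul i _ j m hm, isGreatest_simpleSwap_mul i _ j m h₂ hm'⟩

theorem isGreatest_maxTrans {n : ℕ} (ξ : ConvexRel n) (j : Fin n) :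
    IsGreatest {i | ξ.1 i j} ((maxTrans ξ).1 j) := by
  classical
  constructor
  · have := Finset.max'_mem (Finset.univ.filter fun i ↦ ξ.1 i j) ⟨j, by simpa using ξ.2.refl j⟩
    exact (Finset.mem_filter.1 this).2
  · intro a ha
    exact Finset.le_max' (Finset.univ.filter fun i ↦ ξ.1 i j) a
      (Finset.mem_filter.2 ⟨Finset.mem_univ _, ha⟩)

theorem hasRunningMax_heckeToCatalan {n : ℕ} (w : Perm (Fin n)) :
    HasRunningMax w (heckeToCatalan (heckeElt w)).1 := by
  intro j
  obtain ⟨m, hm, hm'⟩ := exists_isGreatest_of_isReducedWord _ w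
    (exists_reducedWord w).choose_spec j
  have hrel : heckeToRel n (heckeElt w) =
      ((exists_reducedWord w).choose.map epsConvex).prod := by
    rw [heckeElt, map_list_prod, List.map_map]
    rfl
  have h := isGreatest_maxTrans (heckeToRel n (heckeElt w)) j
  rw [hrel] at h
  have e : (heckeToCatalan (heckeElt w)).1 j = m := by
    rw [heckeToCatalan, hrel]
    exact h.unique hm
  rw [e]
  exact hm'

theorem HasRunningMax.unique {n : ℕ} {w : Perm (Fin n)} {α β : Catalan n}
    (hα : HasRunningMax w α.1) (hβ : HasRunningMax w β.1) : α = β :=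
  Subtype.ext (OrderHom.ext _ _ (funext fun j ↦ (hα j).unique (hβ j)))

/-- `w` has a left-to-right maximum at `p`. -/
def IsRecord {n : ℕ} (w : Perm (Fin n)) (p : Fin n) : Prop := ∀ l < p, w l < w p

namespace HasRunningMax

variable {n : ℕ} {w : Perm (Fin n)} {α : Fin n → Fin n}

theorem le (h : HasRunningMax w α) {l p : Fin n} (hl : l ≤ p) : w l ≤ α p :=
  (h p).2 ⟨l, hl, rfl⟩

theorem mono (h : HasRunningMax w α) {l p : Fin n} (hl : l ≤ p) : α l ≤ α p := by
  obtain ⟨j, hj, hj'⟩ := (h l).1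
  exact hj' ▸ h.le (hj.trans hl)

theorem isRecord_iff (h : HasRunningMax w α) (p : Fin n) : IsRecord w p ↔ w p = α p := by
  constructor
  · intro hp
    obtain ⟨j, hj, hj'⟩ := (h p).1
    rcases hj.lt_or_eq with hlt | rfl
    · exact absurd (hp j hlt) (not_lt.2 (hj' ▸ h.le le_rfl))
    · exact hj'
  · intro hp l hl
    exact lt_of_le_of_ne (hp ▸ h.le hl.le) fun e ↦ hl.ne (w.injective e)

/-- Record positions are the points where the running maximum jumps, so they depend on `α` alone. -/
theorem isRecord_iff_forall_lt (h : HasRunningMax w α) (p : Fin n) :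
    IsRecord w p ↔ ∀ l < p, α l < α p := by
  constructor
  · intro hp l hl
    obtain ⟨j, hj, hj'⟩ := (h l).1
    rw [← hj']
    exact (hp j (hj.trans_lt hl)).trans_le (h.le le_rfl)
  · intro hp
    rw [h.isRecord_iff]
    obtain ⟨j, hj, hj'⟩ := (h p).1
    rcases hj.lt_or_eq with hlt | rfl
    · exact absurd (hp j hlt) (not_lt.2 (hj' ▸ h.le le_rfl))
    · exact hj'

theorem exists_isRecord (h : HasRunningMax w α) (p : Fin n) :
    ∃ j ≤ p, w j = α p ∧ IsRecord w j := by
  obtain ⟨j, hj, hj'⟩ := (h p).1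
  exact ⟨j, hj, hj', (h.isRecord_iff j).2 (le_antisymm (h.le le_rfl) (hj' ▸ h.mono hj))⟩

theorem mem_range_iff (h : HasRunningMax w α) (q : Fin n) :
    q ∈ Set.range α ↔ IsRecord w (w⁻¹ q) := by
  constructor
  · rintro ⟨v, rfl⟩
    obtain ⟨j, -, hj, hr⟩ := h.exists_isRecord v
    rwa [← hj, perm_inv_apply]
  · intro hq
    exact ⟨w⁻¹ q, by rw [← (h.isRecord_iff _).1 hq, perm_apply_inv]⟩

end HasRunningMax

/-! ### The order on the Catalan monoid -/

/-- A left factor `γ₁` forces `β` to jump only where `α` does; a right factor `γ₂` forces the range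
of `β` into that of `α`. Together with `α ≤ β` these conditions suffice to build both factors. -/
theorem prec_iff {n : ℕ} (α β : Catalan n) :
    Prec α β ↔ (∀ i, α.1 i ≤ β.1 i) ∧ (∀ p, (∀ l < p, β.1 l < β.1 p) → ∀ l < p, α.1 l < α.1 p) ∧
      Set.range β.1 ⊆ Set.range α.1 := by
  classical
  constructor
  · rintro ⟨γ₁, γ₂, h₁, h₂⟩
    have h₁' : ∀ i, β.1 i = γ₁.1 (α.1 i) := fun i ↦ by rw [h₁]; rfl
    have h₂' : ∀ i, β.1 i = α.1 (γ₂.1 i) := fun i ↦ by rw [h₂]; rfl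
    refine ⟨fun i ↦ h₁' i ▸ γ₁.2 _, fun p hp l hl ↦ ?_, ?_⟩
    · refine lt_of_le_of_ne (α.1.monotone hl.le) fun e ↦ (hp l hl).ne ?_
      rw [h₁', h₁', e]
    · rintro _ ⟨i, rfl⟩
      exact ⟨_, (h₂' i).symm⟩
  · rintro ⟨hle, hker, him⟩
    -- If `β i > β j`, the first point `k` where `β` exceeds `β j` is a jump of `β`, hence of `α`;
    -- as `j < k ≤ i`, this gives `α j < α i`.
    have hker' : ∀ i j, α.1 i ≤ α.1 j → β.1 i ≤ β.1 j := by
      intro i j hij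
      by_contra! hlt
      have hne : (Finset.univ.filter fun k ↦ β.1 j < β.1 k).Nonempty := ⟨i, by simpa using hlt⟩
      have hmin := Finset.isLeast_min' _ hne
      set k := (Finset.univ.filter fun k ↦ β.1 j < β.1 k).min' hne
      have hk : β.1 j < β.1 k := by simpa using hmin.1
      have hki : k ≤ i := hmin.2 (by simpa using hlt)
      have hjk : j < k := lt_of_not_ge fun h ↦ hk.not_ge (β.1.monotone h)
      have := hker k (fun l hl ↦ lt_of_le_of_lt (not_lt.1 fun h ↦
        hl.not_ge (hmin.2 (by simpa using h))) hk) j hjk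
      exact (this.trans_le (α.1.monotone hki)).not_ge hij
    have hne₁ : ∀ x, (insert x ((Finset.univ.filter fun i ↦ α.1 i ≤ x).image β.1)).Nonempty :=
      fun x ↦ Finset.insert_nonempty _ _
    have hne₂ : ∀ i, (Finset.univ.filter fun j ↦ α.1 j = β.1 i).Nonempty := fun i ↦ by
      obtain ⟨j, hj⟩ := him ⟨i, rfl⟩
      exact ⟨j, by simpa using hj⟩
    have hmax : ∀ i, ∃ m, IsGreatest
        (↑(Finset.univ.filter fun j ↦ α.1 j = β.1 i) : Set (Fin n)) m :=
      fun i ↦ ⟨_, Finset.isGreatest_max' _ (hne₂ i)⟩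
    choose g hg using hmax
    have hg₁ : ∀ i, α.1 (g i) = β.1 i := fun i ↦ by simpa using (hg i).1
    have hg₂ : ∀ i j, α.1 j = β.1 i → j ≤ g i := fun i j h ↦ (hg i).2 (by simpa using h)
    -- `γ₁ x` is the maximum of `x` and all `β i` with `α i ≤ x`, the entry `x` making it extensive.
    -- `γ₂ i` is the largest `j` with `α j = β i`; the largest choice ensures `i ≤ γ₂ i`.
    refine ⟨⟨⟨fun x ↦ (insert x ((Finset.univ.filter fun i ↦ α.1 i ≤ x).image β.1)).max'
      (hne₁ x), ?_⟩, ?_⟩, ⟨⟨g, ?_⟩, ?_⟩, ?_, ?_⟩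
    · intro x y hxy
      refine Finset.max'_le _ _ _ fun z hz ↦ ?_
      simp only [Finset.mem_insert, Finset.mem_image, Finset.mem_filter, Finset.mem_univ,
        true_and] at hz
      rcases hz with rfl | ⟨i, hi, rfl⟩
      · exact hxy.trans (Finset.le_max' _ _ (by simp))
      · exact Finset.le_max' _ _ (Finset.mem_insert_of_mem
          (Finset.mem_image_of_mem _ (by simpa using hi.trans hxy)))
    · exact fun x ↦ Finset.le_max' _ _ (by simp)
    · intro i j hij
      rcases (β.1.monotone hij).eq_or_lt with e | e
      · exact hg₂ j _ ((hg₁ i).trans e)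
      · rw [← hg₁, ← hg₁] at e
        exact le_of_not_gt fun h ↦ (α.1.monotone h.le).not_gt e
    · intro i
      rcases (hle i).eq_or_lt with e | e
      · exact hg₂ i i e
      · rw [← hg₁] at e
        exact le_of_not_gt fun h ↦ (α.1.monotone h.le).not_gt e
    · refine Subtype.ext (OrderHom.ext _ _ (funext fun i ↦ le_antisymm ?_ ?_))
      · exact Finset.le_max' _ _ (Finset.mem_insert_of_mem
          (Finset.mem_image_of_mem _ (by simp)))
      · refine Finset.max'_le _ (hne₁ _) _ fun z hz ↦ ?_
        simp only [Finset.mem_insert, Finset.mem_image, Finset.mem_filter, Finset.mem_univ,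
          true_and] at hz
        rcases hz with rfl | ⟨j, hj, rfl⟩
        · exact hle i
        · exact hker' _ _ hj
    · exact Subtype.ext (OrderHom.ext _ _ (funext fun i ↦ (hg₁ i).symm))

/-! ### Records of a permutation and of its inverse -/

theorem prec_iff_records {n : ℕ} {u v : Perm (Fin n)} {α β : Catalan n}
    (hu : HasRunningMax u α.1) (hv : HasRunningMax v β.1) :
    Prec α β ↔ (∀ i, α.1 i ≤ β.1 i) ∧ (∀ p, IsRecord v p → IsRecord u p) ∧
      ∀ q, IsRecord v (v⁻¹ q) → IsRecord u (u⁻¹ q) := by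
  rw [prec_iff]
  simp only [hu.isRecord_iff_forall_lt, hv.isRecord_iff_forall_lt, Set.subset_def,
    hu.mem_range_iff, hv.mem_range_iff]

theorem le_of_forall_lt_perm {n : ℕ} (w : Perm (Fin n)) {p q : Fin n}
    (h : ∀ l < p, w l < q) : p ≤ q := by
  have := Finset.card_le_card_of_injOn (s := Finset.Iio p) (t := Finset.Iio q) w
    (fun l hl ↦ by simpa using h l (by simpa using hl)) w.injective.injOn
  simpa using this

theorem forall_lt_inv {n : ℕ} {w : Perm (Fin n)} {p : Fin n} (h : ∀ l < p, w l < p) :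
    ∀ l < p, w⁻¹ l < p :=
  fun _ hl ↦ Perm.perm_symm_mapsTo_of_mapsTo w (s := Set.Iio p) h hl

/-- All points before `p` have values below `w p`, and all values below `w p` occur before `p`;
counting in both directions gives `w p = p`. -/
theorem IsRecord.apply_eq_self {n : ℕ} {w : Perm (Fin n)} {p : Fin n} (h : IsRecord w p)
    (h' : IsRecord w⁻¹ (w p)) : w p = p := by
  refine le_antisymm (le_of_forall_lt_perm w⁻¹ fun l hl ↦ ?_) (le_of_forall_lt_perm w h)
  have := h' l hl
  rwa [perm_inv_apply] at this

theorem IsRecord.inv_of_apply_eq_self {n : ℕ} {w : Perm (Fin n)} {p : Fin n}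
    (h : IsRecord w p) (e : w p = p) : IsRecord w⁻¹ p := by
  intro l hl
  rw [Perm.inv_eq_iff_eq.2 e.symm]
  exact forall_lt_inv (fun l hl ↦ e ▸ h l hl) l hl

/-- A non-record has a larger value before it; a smaller value after it would complete a 321
pattern. So all smaller values occur earlier. -/
theorem Avoids321.isRecord_inv {n : ℕ} {w : Perm (Fin n)} (hw : Avoids321 w) {p : Fin n}
    (hp : ¬ IsRecord w p) : IsRecord w⁻¹ (w p) := by
  unfold IsRecord at hp
  push Not at hp
  obtain ⟨l, hl, hl'⟩ := hp
  intro u hu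
  rw [perm_inv_apply]
  by_contra! hpu
  rw [← perm_apply_inv w u] at hu
  exact hw ⟨l, p, w⁻¹ u, hl, lt_of_le_of_ne hpu fun e ↦ by simp [← e] at hu,
    lt_of_le_of_ne hl' fun e ↦ hl.ne' (w.injective e), hu⟩

/-! ### Comparison with the 321-avoiding permutation of the same running maximum -/

namespace HasRunningMax

variable {n : ℕ} {w A : Perm (Fin n)} {α : Fin n → Fin n}

theorem isRecord_iff_isRecord (hw : HasRunningMax w α) (hA : HasRunningMax A α) (p : Fin n) :
    IsRecord w p ↔ IsRecord A p := by
  rw [hw.isRecord_iff_forall_lt, hA.isRecord_iff_forall_lt]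

theorem apply_eq_apply (hw : HasRunningMax w α) (hA : HasRunningMax A α) {p : Fin n}
    (hp : IsRecord A p) : w p = A p := by
  rw [(hA.isRecord_iff p).1 hp, ← hw.isRecord_iff, hw.isRecord_iff_isRecord hA]
  exact hp

/-- A record of `w` whose value is a record of `w⁻¹` is a fixed point; `A` agrees with `w` there,
and a fixed record is also a record of the inverse. -/
theorem isRecord_inv_of_isRecord (hw : HasRunningMax w α) (hA : HasRunningMax A α) {p : Fin n}
    (hp : IsRecord w p) (hp' : IsRecord w⁻¹ (w p)) : IsRecord A⁻¹ (A p) := by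
  have hpA := (hw.isRecord_iff_isRecord hA p).1 hp
  have e := hp.apply_eq_self hp'
  rw [hw.apply_eq_apply hA hpA] at e
  rw [e]
  exact hpA.inv_of_apply_eq_self e

theorem isRecord_inv_apply (hw : HasRunningMax w α) (hA : HasRunningMax A α)
    (av : Avoids321 A) {p : Fin n} (hp : IsRecord w⁻¹ (w p)) : IsRecord A⁻¹ (A p) := by
  by_cases h : IsRecord A p
  · exact hw.isRecord_inv_of_isRecord hA ((hw.isRecord_iff_isRecord hA p).2 h) hp
  · exact av.isRecord_inv h

theorem isRecord_inv (hw : HasRunningMax w α) (hA : HasRunningMax A α)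
    (av : Avoids321 A) {v : Fin n} (hv : IsRecord w⁻¹ v) : IsRecord A⁻¹ v := by
  rw [← perm_apply_inv A v]
  by_cases h : IsRecord A (A⁻¹ v)
  · refine hw.isRecord_inv_of_isRecord hA ((hw.isRecord_iff_isRecord hA _).2 h) ?_
    rwa [hw.apply_eq_apply hA h, perm_apply_inv]
  · exact av.isRecord_inv h

/-- Among the permutations with a given running maximum, the `321`-avoiding one has the inverse
with the smallest running maximum. -/
theorem inv_le_inv (hw : HasRunningMax w α) (hA : HasRunningMax A α)
    (av : Avoids321 A) {β γ : Fin n → Fin n} (hβ : HasRunningMax w⁻¹ β)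
    (hγ : HasRunningMax A⁻¹ γ) (v : Fin n) : γ v ≤ β v := by
  classical
  obtain ⟨u, hu, hu'⟩ := (hγ v).1
  rw [← hu']
  set p := A⁻¹ u with hp
  have hpu : A p = u := perm_apply_inv A u
  by_cases h : IsRecord A p
  · have := hβ.le hu
    rwa [← hpu, ← hw.apply_eq_apply hA h, perm_inv_apply] at this
  · by_contra! hlt
    -- `T` consists of the non-record values of `A` up to `u`. If `w⁻¹` sends everything up to `v`
    -- before `p`, then `A * w⁻¹` maps `T` into itself and misses `u`: a non-record of `A` before
    -- `p` has a value below `A p = u`, since `A` avoids 321. This contradicts injectivity.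
    let T := Finset.univ.filter fun x ↦ x ≤ u ∧ ¬ IsRecord A (A⁻¹ x)
    have huT : u ∈ T := by
      refine Finset.mem_filter.2 ⟨Finset.mem_univ _, le_rfl, h⟩
    have hmaps : ∀ x ∈ T, (A * w⁻¹) x ∈ T.erase u := by
      intro x hx
      obtain ⟨-, hxu, hx⟩ := Finset.mem_filter.1 hx
      have hxp : w⁻¹ x < p := (hβ.le (hxu.trans hu)).trans_lt hlt
      have hrec : ¬ IsRecord A (w⁻¹ x) := fun hr ↦ by
        have e := hw.apply_eq_apply hA hr
        rw [perm_apply_inv] at e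
        apply hx
        rw [e, perm_inv_apply]
        exact hr
      have hlt' : A (w⁻¹ x) < u := by
        rw [← hpu]
        refine lt_of_le_of_ne (not_lt.1 fun hgt ↦ ?_) fun e ↦ hxp.ne (A.injective e)
        have := av.isRecord_inv hrec _ hgt
        rw [perm_inv_apply, perm_inv_apply] at this
        exact this.not_gt hxp
      refine Finset.mem_erase.2 ⟨hlt'.ne, Finset.mem_filter.2 ⟨Finset.mem_univ _, hlt'.le, ?_⟩⟩
      rwa [Perm.mul_apply, perm_inv_apply]
    have := Finset.card_le_card_of_injOn _ hmaps (A * w⁻¹).injective.injOn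
    exact this.not_gt (Finset.card_erase_lt_of_mem huT)

theorem prec_inv {α β γ : Catalan n} (hw : HasRunningMax w α.1) (hA : HasRunningMax A α.1)
    (av : Avoids321 A) (hβ : HasRunningMax w⁻¹ β.1) (hγ : HasRunningMax A⁻¹ γ.1) :
    Prec γ β := by
  rw [prec_iff_records hγ hβ, inv_inv, inv_inv]
  exact ⟨hw.inv_le_inv hA av hβ hγ, fun _ ↦ hw.isRecord_inv hA av,
    fun _ ↦ hw.isRecord_inv_apply hA av⟩

end HasRunningMax

/-! ### Constructing a permutation from its records -/

/-- The complements of `T` and of its image have equal size, so the increasing bijection between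
them fills in the rest. -/
theorem exists_perm_extending {n : ℕ} (T : Finset (Fin n)) (g : Fin n → Fin n)
    (hg : Set.InjOn g T) :
    ∃ w : Perm (Fin n), (∀ p ∈ T, w p = g p) ∧ ∀ p q, p ∉ T → q ∉ T → p < q → w p < w q := by
  classical
  have hcard : (T.image g)ᶜ.card = Tᶜ.card := by
    rw [Finset.card_compl, Finset.card_compl, Finset.card_image_of_injOn hg]
  let f := (Tᶜ.orderIsoOfFin rfl).symm.trans ((T.image g)ᶜ.orderIsoOfFin hcard)
  have hf : ∀ x, (f x : Fin n) ∉ T.image g := fun x ↦ Finset.mem_compl.1 (f x).2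
  let F : Fin n → Fin n := fun p ↦
    if h : p ∈ T then g p else f ⟨p, Finset.mem_compl.2 h⟩
  have hF : Function.Injective F := by
    intro p q hpq
    simp only [F] at hpq
    split_ifs at hpq with hp hq hq
    · exact hg hp hq hpq
    · exact absurd (hpq ▸ Finset.mem_image_of_mem g hp) (hf _)
    · exact absurd (hpq ▸ Finset.mem_image_of_mem g hq) (hf _)
    · exact congrArg Subtype.val (f.injective (Subtype.ext hpq))
  refine ⟨Equiv.ofBijective F (Finite.injective_iff_bijective.1 hF), fun p hp ↦ ?_,
    fun p q hp hq hpq ↦ ?_⟩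
  · exact dif_pos hp
  · change F p < F q
    simp only [F, dif_neg hp, dif_neg hq]
    exact f.strictMono hpq

/-! ### Gluing the records of two permutations -/

variable {n : ℕ} {A B w : Perm (Fin n)} {α β γA γB : Catalan n}

/-- Compatibility of the prescriptions `w p = A p` and `w⁻¹ v = B v` when `B v = p`: both then read
`w p = p`. From `h₁` the value `A p` is a record position of `A⁻¹`, so `p` is fixed by `A`; from
`h₂` the map `B⁻¹` preserves the points below `p`, which excludes `v < p`. -/
theorem eq_of_isRecord_of_isRecord (hA : HasRunningMax A α.1) (hB : HasRunningMax B β.1)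
    (hγA : HasRunningMax A⁻¹ γA.1) (hγB : HasRunningMax B⁻¹ γB.1)
    (h₁ : Prec γA β) (h₂ : Prec γB α) {p v : Fin n} (hp : IsRecord A p) (hv : IsRecord B v)
    (e : B v = p) : p = v ∧ A p = p := by
  rw [prec_iff_records hγA hB, inv_inv] at h₁
  have hpA : A p = p := hp.apply_eq_self
    (h₁.2.2 p (by rw [← e, perm_inv_apply]; exact hv))
  have hαp : α.1 p = p := by rw [← (hA.isRecord_iff p).1 hp, hpA]
  have hle : ∀ l, B⁻¹ l ≤ α.1 l := fun l ↦ (hγB.le le_rfl).trans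
    ((prec_iff_records hγB hA).1 h₂ |>.1 l)
  have hlt : ∀ l < p, B⁻¹ l < p := fun l hl ↦ (hle l).trans_lt
    (((hA.isRecord_iff_forall_lt p).1 hp l hl).trans_eq hαp)
  have hvp : v ≤ p := by
    have := hle p
    rwa [hαp, ← e, perm_inv_apply, e] at this
  refine ⟨(hvp.eq_or_lt.resolve_right fun h ↦ ?_).symm, hpA⟩
  have := forall_lt_inv hlt v h
  rw [inv_inv, e] at this
  exact this.false

theorem hasRunningMax_of_extends (hA : HasRunningMax A α.1) (hB : HasRunningMax B β.1)
    (hγA : HasRunningMax A⁻¹ γA.1) (hγB : HasRunningMax B⁻¹ γB.1)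
    (h₁ : Prec γA β) (h₂ : Prec γB α) (hwA : ∀ p, IsRecord A p → w p = A p)
    (hwB : ∀ v, IsRecord B v → w⁻¹ v = B v)
    (hmono : ∀ p q, ¬ IsRecord A p → ¬ IsRecord B (w p) → ¬ IsRecord A q →
      ¬ IsRecord B (w q) → p < q → w p < w q) : HasRunningMax w α.1 := by
  classical
  have hle₁ := ((prec_iff_records hγA hB).1 h₁).1
  have hle₂ := ((prec_iff_records hγB hA).1 h₂).1
  have key : ∀ r, w r ≤ α.1 r := by
    intro r
    by_cases hrA : IsRecord A r
    · exact hwA r hrA ▸ hA.le le_rfl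
    -- Here `r = β (w r)`, while `γA ≤ β` puts the position of the value `w r` in `A` at or before
    -- `r`; so `α r` is at least `w r`.
    by_cases hrB : IsRecord B (w r)
    · have e := hwB _ hrB
      rw [perm_inv_apply, (hB.isRecord_iff _).1 hrB] at e
      have := hA.le ((hγA.le (le_refl (w r))).trans (hle₁ (w r)))
      rwa [perm_apply_inv, ← e] at this
    by_contra! hlt
    -- `X` consists of the `p ≤ r` that are not record values of `B`. Since `γB ≤ α`, the value `B⁻¹
    -- p` is at most `α r < w r`, so `w` takes it strictly before `r`: a later record of `A` would
    -- have value above `α r`, and `w` increases on the free points. Thus `w⁻¹ * B⁻¹` injects `X`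
    -- into `X` without `r`.
    let X := Finset.univ.filter fun p ↦ p ≤ r ∧ ¬ IsRecord B (B⁻¹ p)
    have hmaps : ∀ p ∈ X, (w⁻¹ * B⁻¹) p ∈ X.erase r := by
      intro p hp
      obtain ⟨-, hpr, hp⟩ := Finset.mem_filter.1 hp
      have hv : B⁻¹ p ≤ α.1 r := (hγB.le hpr).trans (hle₂ r)
      have hwq : w (w⁻¹ (B⁻¹ p)) = B⁻¹ p := perm_apply_inv _ _
      rw [Perm.mul_apply]
      generalize hq : w⁻¹ (B⁻¹ p) = q at hwq ⊢
      rw [← hwq] at hv hp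
      have hqr : q < r := by
        refine lt_of_le_of_ne (not_lt.1 fun h ↦ ?_) fun e ↦ (hv.trans_lt hlt).ne (e ▸ rfl)
        by_cases hqA : IsRecord A q
        · have := (hA.isRecord_iff_forall_lt q).1 hqA r h
          rw [← (hA.isRecord_iff q).1 hqA, ← hwA q hqA] at this
          exact this.not_ge hv
        · exact (hmono r q hrA hrB hqA hp h).not_gt (hv.trans_lt hlt)
      refine Finset.mem_erase.2 ⟨hqr.ne, Finset.mem_filter.2 ⟨Finset.mem_univ _, hqr.le, ?_⟩⟩
      intro h
      have e := hwB _ h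
      rw [perm_apply_inv, Perm.inv_eq_iff_eq] at e
      exact hp (e ▸ h)
    have hcard := Finset.card_le_card_of_injOn _ hmaps (w⁻¹ * B⁻¹).injective.injOn
    refine hcard.not_gt (Finset.card_erase_lt_of_mem ?_)
    refine Finset.mem_filter.2 ⟨Finset.mem_univ _, le_rfl, fun h ↦ ?_⟩
    have e := hwB _ h
    rw [perm_apply_inv, Perm.inv_eq_iff_eq] at e
    exact hrB (e ▸ h)
  intro p
  constructor
  · obtain ⟨j, hj, hj', hr⟩ := hA.exists_isRecord p
    exact ⟨j, hj, (hwA j hr).trans hj'⟩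
  · rintro x ⟨l, hl, rfl⟩
    exact (key l).trans (hA.mono hl)

theorem exists_perm_hasRunningMax (hA : HasRunningMax A α.1) (hB : HasRunningMax B β.1)
    (hγA : HasRunningMax A⁻¹ γA.1) (hγB : HasRunningMax B⁻¹ γB.1)
    (h₁ : Prec γA β) (h₂ : Prec γB α) :
    ∃ w : Perm (Fin n), HasRunningMax w α.1 ∧ HasRunningMax w⁻¹ β.1 := by
  classical
  let g : Fin n → Fin n := fun p ↦ if IsRecord A p then A p else B⁻¹ p
  have hAB : ∀ p q, IsRecord A p → IsRecord B (B⁻¹ q) → A p = B⁻¹ q → p = q := by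
    intro p q hp hq e
    obtain ⟨e₁, e₂⟩ := eq_of_isRecord_of_isRecord hB hA hγB hγA h₂ h₁ hq hp e
    rw [perm_apply_inv] at e₂
    rw [← e₁, ← e₂]
  obtain ⟨w, hw, hmono⟩ := exists_perm_extending
    (Finset.univ.filter fun p ↦ IsRecord A p ∨ IsRecord B (B⁻¹ p)) g (by
      intro p hp q hq hpq
      simp only [Finset.coe_filter, Finset.mem_univ, true_and, Set.mem_ofPred_eq] at hp hq
      simp only [g] at hpq
      split_ifs at hpq with h h' h'
      · exact A.injective hpq
      · exact hAB p q h (hq.resolve_left h') hpq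
      · exact (hAB q p h' (hp.resolve_left h) hpq.symm).symm
      · exact B⁻¹.injective hpq)
  simp only [Finset.mem_filter, Finset.mem_univ, true_and, not_or] at hw hmono
  have hwA : ∀ p, IsRecord A p → w p = A p := fun p hp ↦ (hw p (Or.inl hp)).trans (if_pos hp)
  have hwB : ∀ v, IsRecord B v → w⁻¹ v = B v := by
    intro v hv
    rw [Perm.inv_eq_iff_eq, hw (B v) (Or.inr (by rwa [perm_inv_apply]))]
    simp only [g]
    split_ifs with h
    · obtain ⟨e₁, e₂⟩ := eq_of_isRecord_of_isRecord hA hB hγA hγB h₁ h₂ h hv rfl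
      rw [e₂, e₁]
    · rw [perm_inv_apply]
  -- A point `p` that is a record value of `B` but not a record of `A` gets the value `B⁻¹ p`, a
  -- record position of `B`; so the points free in the sense of `hasRunningMax_of_extends` lie
  -- outside the prescribed set.
  have hT : ∀ p, ¬ IsRecord A p → ¬ IsRecord B (w p) → ¬ IsRecord B (B⁻¹ p) := by
    intro p hp hp' h
    rw [hw p (Or.inr h)] at hp'
    simp only [g, if_neg hp] at hp'
    exact hp' h
  have hmono' : ∀ p q, ¬ IsRecord A p → ¬ IsRecord B (w p) → ¬ IsRecord A q →
      ¬ IsRecord B (w q) → p < q → w p < w q := fun p q hp hp' hq hq' ↦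
    hmono p q ⟨hp, hT p hp hp'⟩ ⟨hq, hT q hq hq'⟩
  refine ⟨w, hasRunningMax_of_extends hA hB hγA hγB h₁ h₂ hwA hwB hmono',
    hasRunningMax_of_extends hB hA hγB hγA h₂ h₁ hwB (by rwa [inv_inv]) ?_⟩
  intro v v' hv hv' hu hu' hvv
  -- Monotonicity on the free points passes to the inverse: an inversion of `w⁻¹` would be an
  -- inversion of `w`.
  by_contra! hle
  have := hmono' _ _ hu' (by rwa [perm_apply_inv]) hv' (by rwa [perm_apply_inv])
    (lt_of_le_of_ne hle fun e ↦ hvv.ne' (w⁻¹.injective e))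
  rw [perm_apply_inv, perm_apply_inv] at this
  exact this.not_gt hvv

/-! ### Admissibility in terms of running maxima -/

theorem heckeToCatalan_eq_iff (w : Perm (Fin n)) (α : Catalan n) :
    heckeToCatalan (heckeElt w) = α ↔ HasRunningMax w α.1 := by
  constructor
  · rintro rfl
    exact hasRunningMax_heckeToCatalan w
  · exact (hasRunningMax_heckeToCatalan w).unique

theorem isAdmissible_delta_iff (α β : Catalan n) :
    IsAdmissible (delta n α) (delta n β) ↔
      ∃ w : Perm (Fin n), HasRunningMax w α.1 ∧ HasRunningMax w⁻¹ β.1 := by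
  simp only [IsAdmissible, dyckPair, Prod.mk.injEq, (delta n).injective.eq_iff,
    heckeToCatalan_eq_iff]

end DoubleCatalan

open DoubleCatalan in
theorem mainTheorem10 (n : ℕ) (δ δ' : DoubleCatalan.DyckPath n) :
    DoubleCatalan.IsAdmissible δ δ' ↔
      DoubleCatalan.Prec ((DoubleCatalan.delta n).symm (DoubleCatalan.krewerasDerivative δ))
          ((DoubleCatalan.delta n).symm δ') ∧
        DoubleCatalan.Prec ((DoubleCatalan.delta n).symm (DoubleCatalan.krewerasDerivative δ'))
          ((DoubleCatalan.delta n).symm δ) := by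
  obtain ⟨α, rfl⟩ := (delta n).surjective δ
  obtain ⟨β, rfl⟩ := (delta n).surjective δ'
  simp only [isAdmissible_delta_iff, krewerasDerivative, Equiv.symm_apply_apply]
  have hA : HasRunningMax (piPerm α) α.1 := isGreatest_piPerm α
  have hB : HasRunningMax (piPerm β) β.1 := isGreatest_piPerm β
  have hγA := hasRunningMax_heckeToCatalan (piPerm α)⁻¹
  have hγB := hasRunningMax_heckeToCatalan (piPerm β)⁻¹
  constructor
  · rintro ⟨w, hα, hβ⟩
    exact ⟨hα.prec_inv hA (avoids321_piPerm α) hβ hγA,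
      hβ.prec_inv hB (avoids321_piPerm β) (by rwa [inv_inv]) hγB⟩
  · rintro ⟨h₁, h₂⟩
    exact exists_perm_hasRunningMax hA hB hγA hγB h₁ h₂
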